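/- Let $B$ be a separable real Banach space with dual $Z=B^*$ and pairing $\langle b,z\rangle$. A $Z$-graphon is a symmetric function $W:[0,1]^2\to Z$ such that $(x,y)\mapsto\langle b,W(x,y)\rangle$ is measurable for every $b\in B$ and $(x,y)\mapsto\|W(x,y)\|_Z$ lies in $L^p([0,1]^2)$ for every $1\le p<\infty$. A $B$-decorated graph is a pair $\mathbf F=(F,f)$, where $F$ is a finite simple graph (without loops) and $f:E(F)\to B$. A $Z$-decorated complete graph is a pair $\mathbf G=(G,g)$, where $G$ is a complete graph and $g$ assigns an element of $Z$ to every unordered pair $ij$ of nodes, including the pairs $ii$ (where the value $0$ means that there is no loop). Put $$t(\mathbf F,\mathbf G)=\frac1{|V(G)|^{|V(F)|}}\sum_{\varphi:V(F)\to V(G)}\ \prod_{ij\in E(F)}\langle f(ij),g(\varphi(i)\varphi(j))\rangle,$$ $$t(\mathbf F,W)=\int_{[0,1]^{V(F)}}\ \prod_{ij\in E(F)}\langle f(ij),W(x_i,x_j)\rangle\,dx .$$ A sequence $(\mathbf G_n)$ of $Z$-decorated complete graphs is convergent if $(t(\mathbf F,\mathbf G_n))_n$ converges for every $B$-decorated graph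 $\mathbf F$, and its limit is $W$ if $t(\mathbf F,\mathbf G_n)\to t(\mathbf F,W)$ for every such $\mathbf F$. For $n\ge1$, the $W$-random decorated graph $\mathbb G(n,W)$ on $\{1,\dots,n\}$ is obtained from independent uniformly distributed points $x_1,\dots,x_n\in[0,1]$ by labelling every pair $ij$ with $i\neq j$ by $W(x_i,x_j)$ and every pair $ii$ by a fixed $z_0\in Z$ (for instance $z_0=0$). Theorem. For every $Z$-graphon $W$, every $B$-decorated graph $\mathbf F$ and every $z_0\in Z$, $$t(\mathbf F,\mathbb G(n,W))\to t(\mathbf F,W)\qquad(n\to\infty)$$ with probability $1$, whatever the joint distribution of the random graphs $\mathbb G(n,W)$ for different $n$. Corollary. Every $Z$-graphon is the limit of a convergent sequence $(\mathbf G_n)_{n\ge1}$ of $Z$-decorated complete graphs without loops, where $\mathbf G_n$ has $n$ nodes. -/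

import Mathlib

open MeasureTheory ProbabilityTheory Filter Topology
open scoped unitInterval ENNReal

noncomputable section

namespace BanachGraphon

/-- An `X`-decorated simple graph `(F, f)` on the node set `V`: a simple (loopless) graph together
with a decoration `f : E(F) → X` of its edges. -/
structure DecoratedGraph (X : Type*) (V : Type*) where
  graph : SimpleGraph V
  dec : graph.edgeSet → X

/-- An `X`-decorated complete graph on the node set `V`: every unordered pair `ij` of nodes carries
an element of `X`. The pairs `ii` are included, because a map `V(F) → V(G)` may identify adjacent
nodes; if `X` has a zero, label `0` on the pairs `ii` means that there are no loops. -/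
structure CompleteDecoratedGraph (X : Type*) (V : Type*) where
  dec : Sym2 V → X

section

variable (B : Type*) [NormedAddCommGroup B] [NormedSpace ℝ B]

/-- A `Z`-graphon, `Z` being the dual of `B`: a symmetric function `W : [0,1]² → Z` such that
`⟨b, W⟩` is (Lebesgue) measurable for every `b ∈ B` and such that `(x, y) ↦ ‖W(x, y)‖` lies in
`L^p([0,1]²)` for all `1 ≤ p < ∞`. -/
structure ZGraphon where
  toFun : I → I → StrongDual ℝ B
  symm' : ∀ x y, toFun x y = toFun y x
  weakStarMeasurable' :
    ∀ b : B, AEMeasurable (fun p : I × I => toFun p.1 p.2 b) (volume : Measure (I × I))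
  memLp_norm' : ∀ p : ℝ≥0∞, 1 ≤ p → p ≠ ∞ →
    MemLp (fun q : I × I => ‖toFun q.1 q.2‖) p (volume : Measure (I × I))

end

section

variable {B : Type*} [NormedAddCommGroup B] [NormedSpace ℝ B]

/-- For points `x_v ∈ [0,1]` (`v ∈ V`), the label `W(x_i, x_j)` of the unordered pair `ij`. -/
def ZGraphon.onPair (W : ZGraphon B) {V : Type*} (x : V → I) : Sym2 V → StrongDual ℝ B :=
  Sym2.lift ⟨fun i j => W.toFun (x i) (x j), fun i j => W.symm' (x i) (x j)⟩

open Classical in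
/-- `hom(F, G) = ∑_{φ : V(F) → V(G)} ∏_{e ∈ E(F)} ⟨f(e), g(φ(e))⟩`. -/
def hom {V U : Type*} [Fintype V] [Fintype U] (F : DecoratedGraph B V)
    (G : CompleteDecoratedGraph (StrongDual ℝ B) U) : ℝ :=
  ∑ φ : V → U, ∏ e : F.graph.edgeSet, G.dec (Sym2.map φ (e : Sym2 V)) (F.dec e)

/-- The homomorphism density `t(F, G) = hom(F, G) / |V(G)|^{|V(F)|}`. -/
def homDensity {V U : Type*} [Fintype V] [Fintype U] (F : DecoratedGraph B V)
    (G : CompleteDecoratedGraph (StrongDual ℝ B) U) : ℝ :=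
  hom F G / (Fintype.card U : ℝ) ^ Fintype.card V

open Classical in
/-- The density `t(F, W) = ∫_{[0,1]^{V(F)}} ∏_{ij ∈ E(F)} ⟨f(ij), W(x_i, x_j)⟩ dx`. -/
def graphonDensity {V : Type*} [Fintype V] (F : DecoratedGraph B V) (W : ZGraphon B) : ℝ :=
  ∫ x : V → I, ∏ e : F.graph.edgeSet, W.onPair x (e : Sym2 V) (F.dec e)

open Classical in
/-- The decorated complete graph on `[n]` sampled from `W` at the points `x_1, …, x_n`: the pair
`ij` with `i ≠ j` is labelled by `W(x_i, x_j)`. Sampling labels no pair `ii`; these get the label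
`z₀` (`z₀ = 0` for a graph without loops). -/
def sampledGraph (W : ZGraphon B) (z₀ : StrongDual ℝ B) {n : ℕ} (x : Fin n → I) :
    CompleteDecoratedGraph (StrongDual ℝ B) (Fin n) where
  dec e := if e.IsDiag then z₀ else W.onPair x e

/-- A sequence of `Z`-decorated complete graphs, the `n`-th one with `N n` nodes, is convergent if
`t(F, G_n)` converges for every `B`-decorated graph `F`. -/
def IsConvergent {N : ℕ → ℕ}
    (G : ∀ n, CompleteDecoratedGraph (StrongDual ℝ B) (Fin (N n))) : Prop :=
  ∀ (k : ℕ) (F : DecoratedGraph B (Fin k)),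
    ∃ c : ℝ, Tendsto (fun n => homDensity F (G n)) atTop (𝓝 c)

/-- `W` is a limit of the sequence `G_n`: `t(F, G_n) → t(F, W)` for every `B`-decorated graph
`F`. -/
def IsLimit {N : ℕ → ℕ}
    (G : ∀ n, CompleteDecoratedGraph (StrongDual ℝ B) (Fin (N n))) (W : ZGraphon B) : Prop :=
  ∀ (k : ℕ) (F : DecoratedGraph B (Fin k)),
    Tendsto (fun n => homDensity F (G n)) atTop (𝓝 (graphonDensity F W))

end

end BanachGraphon

end

open MeasureTheory ProbabilityTheory Filter Topology
open scoped unitInterval ENNReal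

noncomputable section

namespace BanachGraphon


/-! The error `t(F, G(n, W)) - t(F, W)` is the average, over the maps `φ : V(F) → [n]`, of the
centred contributions `homWeight φ - t(F, W)`. Its fourth power is an average over quadruples of
maps. If one map of a quadruple is injective and its range misses the other three ranges, its factor
has mean zero and is independent of the rest, so the term integrates to zero
(`integral_prod_homWeight_sub_eq_zero`). A quadruple without such a map has two independent
coincidences among its `4k` values, so at most `(4k)^4 n^(4k-2)` quadruples survive
(`card_filter_no_isIsolated_mul_sq_le`), each with a bounded integral because `‖W‖` has all moments.
Hence the fourth moment of the error is `O(n⁻²)`. This is summable, which gives almost sure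
convergence under any coupling; the variance is in general only of order `1/n`. Loops are seen only
by non-injective maps, so `z₀` affects only constants.

The corollary needs one sample that serves uncountably many `F`. For a fixed graph, the density is
locally Lipschitz in the decoration, with a constant governed by the density of the same graph in
`‖W‖`, which converges too. Countably many decorations from a dense sequence of `B` therefore
suffice. -/

theorem abs_prod_le_one_add_sum_pow_card {ι : Type*} [Fintype ι] (a : ι → ℝ) :
    |∏ i, a i| ≤ 1 + ∑ i, |a i| ^ Fintype.card ι := by
  rw [Finset.abs_prod]
  rcases isEmpty_or_nonempty ι with h | h
  · simp
  obtain ⟨i₀, hi₀⟩ := Finite.exists_max (fun i => |a i|)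
  calc ∏ i, |a i| ≤ ∏ _i : ι, |a i₀| :=
        Finset.prod_le_prod (fun _ _ => abs_nonneg _) (fun i _ => hi₀ i)
    _ = |a i₀| ^ Fintype.card ι := by simp
    _ ≤ ∑ i, |a i| ^ Fintype.card ι :=
        Finset.single_le_sum (f := fun i => |a i| ^ Fintype.card ι)
          (fun i _ => by positivity) (Finset.mem_univ i₀)
    _ ≤ _ := by linarith

/-! ### Independence of the coordinates of the cube -/

theorem measurePreserving_comp_injective {α β : Type*} [Fintype α] [Fintype β] {φ : α → β}
    (hφ : Function.Injective φ) :
    MeasurePreserving (fun (x : β → I) (i : α) => x (φ i)) := by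
  refine ⟨by fun_prop, ?_⟩
  have h : iIndepFun (fun (i : β) (x : β → I) => x i) (volume : Measure (β → I)) :=
    iIndepFun_pi (X := fun (_ : β) (t : I) => t) (μ := fun _ => volume) (by fun_prop)
  have h2 := (iIndepFun_iff_map_fun_eq_pi_map
    fun i => (measurable_pi_apply (φ i)).aemeasurable).1 (h.precomp hφ)
  refine h2.trans ?_
  rw [volume_pi]
  congr 1
  ext1 i
  exact (measurePreserving_eval (fun _ : β => (volume : Measure I)) (φ i)).map_eq

theorem measurePreserving_pair {β : Type*} [Fintype β] {i j : β} (hij : i ≠ j) :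
    MeasurePreserving (fun x : β → I => (x i, x j)) := by
  refine ⟨by fun_prop, ?_⟩
  have h : iIndepFun (fun (i : β) (x : β → I) => x i) (volume : Measure (β → I)) :=
    iIndepFun_pi (X := fun (_ : β) (t : I) => t) (μ := fun _ => volume) (by fun_prop)
  have h2 := (h.indepFun hij).map_prod_eq_prod_map_map
    (measurable_pi_apply i).aemeasurable (measurable_pi_apply j).aemeasurable
  refine h2.trans ?_
  have e := fun i : β => (measurePreserving_eval (fun _ : β => (volume : Measure I)) i).map_eq
  rw [Measure.volume_eq_prod]
  congr 1
  exacts [e i, e j]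

theorem integral_mul_of_restrict {β : Type*} [Fintype β] (p : β → Prop) [DecidablePred p]
    (f : ({i // p i} → I) → ℝ) (g : ({i // ¬ p i} → I) → ℝ) :
    ∫ x : β → I, f (fun i => x i) * g (fun i => x i) = (∫ y, f y) * ∫ y, g y := by
  rw [← integral_prod_mul]
  exact (volume_preserving_piEquivPiSubtypeProd (fun _ : β => I) p).integral_comp'
    (fun z => f z.1 * g z.2)

/-- Functions of disjoint sets of coordinates are uncorrelated; no measurability is needed. -/
theorem integral_mul_of_dependsOn {β : Type*} [Fintype β] {s t : Set β} (hst : Disjoint s t)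
    {f g : (β → I) → ℝ} (hf : DependsOn f s) (hg : DependsOn g t) :
    ∫ x, f x * g x = (∫ x, f x) * ∫ x, g x := by
  classical
  -- The missing coordinates are filled with 0, which is harmless because `f` ignores them.
  let f' : ({i // i ∈ s} → I) → ℝ := fun y => f fun i => if h : i ∈ s then y ⟨i, h⟩ else 0
  let g' : ({i // i ∉ s} → I) → ℝ := fun y => g fun i => if h : i ∉ s then y ⟨i, h⟩ else 0
  have ef : ∀ x, f x = f' fun i => x i := fun x => hf fun i hi => by simp [hi]
  have eg : ∀ x, g x = g' fun i => x i := fun x => hg fun i hi => by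
    simp [Set.disjoint_right.1 hst hi]
  have h1 := integral_mul_of_restrict (· ∈ s) f' g'
  -- A constant second factor identifies the integral over the restricted cube with the one over the
  -- full cube.
  have h2 := integral_mul_of_restrict (· ∈ s) f' (fun _ => 1)
  have h3 := integral_mul_of_restrict (· ∈ s) (fun _ => 1) g'
  simp only [mul_one, one_mul, integral_const, probReal_univ, smul_eq_mul] at h2 h3
  simp only [ef, eg, h1, h2, h3]

variable {B : Type*} [NormedAddCommGroup B] [NormedSpace ℝ B]

/-! ### Moments of the labels and of the contributions of maps -/

theorem ZGraphon.memLp_apply (W : ZGraphon B) (b : B) (q : ℕ) :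
    MemLp (fun p : I × I => W.toFun p.1 p.2 b) q := by
  -- The norm is controlled only for exponents at least 1; the exponent 0 follows by monotonicity on
  -- a probability space.
  have h : MemLp (fun p : I × I => W.toFun p.1 p.2 b) (max q 1 : ℕ) := by
    refine MemLp.of_le_mul (c := ‖b‖) (W.memLp_norm' (max q 1 : ℕ) ?_ (by simp))
      (W.weakStarMeasurable' b).aestronglyMeasurable (ae_of_all _ fun p => ?_)
    · exact_mod_cast le_max_right q 1
    · rw [norm_norm, mul_comm]
      exact (W.toFun p.1 p.2).le_opNorm b
  exact h.mono_exponent (by exact_mod_cast le_max_left q 1)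

@[simp]
theorem sampledGraph_dec_mk (W : ZGraphon B) (z₀ : StrongDual ℝ B) {n : ℕ} (x : Fin n → I)
    (i j : Fin n) :
    (sampledGraph W z₀ x).dec s(i, j) = if i = j then z₀ else W.toFun (x i) (x j) := by
  simp [sampledGraph, ZGraphon.onPair]

theorem memLp_sampledGraph_dec (W : ZGraphon B) (z₀ : StrongDual ℝ B) {n : ℕ}
    (e : Sym2 (Fin n)) (b : B) (q : ℕ) :
    MemLp (fun x : Fin n → I => (sampledGraph W z₀ x).dec e b) q := by
  induction e with | _ i j
  by_cases hij : i = j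
  · simpa [hij] using memLp_const (z₀ b)
  · simp only [sampledGraph_dec_mk, hij, if_false]
    exact (W.memLp_apply b q).comp_measurePreserving (measurePreserving_pair hij)

theorem integral_abs_sampledGraph_dec_pow_le (W : ZGraphon B) (z₀ : StrongDual ℝ B) {n : ℕ}
    (e : Sym2 (Fin n)) (b : B) (q : ℕ) :
    ∫ x : Fin n → I, |(sampledGraph W z₀ x).dec e b| ^ q ≤
      |z₀ b| ^ q + ∫ p : I × I, |W.toFun p.1 p.2 b| ^ q := by
  induction e with | _ i j
  by_cases hij : i = j
  · simpa [hij] using integral_nonneg fun p => by positivity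
  · simp only [sampledGraph_dec_mk, hij, if_false]
    have h := measurePreserving_pair hij
    have h2 : ∫ x : Fin n → I, |W.toFun (x i) (x j) b| ^ q =
        ∫ p : I × I, |W.toFun p.1 p.2 b| ^ q := by
      rw [← h.map_eq, integral_map h.aemeasurable]
      rw [h.map_eq]
      exact (((W.memLp_apply b 0).1.aemeasurable.abs).pow_const q).aestronglyMeasurable
    rw [h2]
    exact le_add_of_nonneg_left (by positivity)

open Classical in
/-- The contribution of the map `φ` to `hom(F, G)`, where `G` is sampled from `W` at the points
`x`. -/
def homWeight (W : ZGraphon B) (z₀ : StrongDual ℝ B) {k n : ℕ} (F : DecoratedGraph B (Fin k))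
    (φ : Fin k → Fin n) (x : Fin n → I) : ℝ :=
  ∏ e : F.graph.edgeSet, (sampledGraph W z₀ x).dec (Sym2.map φ (e : Sym2 (Fin k))) (F.dec e)

theorem hom_sampledGraph (W : ZGraphon B) (z₀ : StrongDual ℝ B) {k n : ℕ}
    (F : DecoratedGraph B (Fin k)) (x : Fin n → I) :
    hom F (sampledGraph W z₀ x) = ∑ φ : Fin k → Fin n, homWeight W z₀ F φ x := by
  unfold hom homWeight
  congr!

theorem dependsOn_homWeight (W : ZGraphon B) (z₀ : StrongDual ℝ B) {k n : ℕ}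
    (F : DecoratedGraph B (Fin k)) (φ : Fin k → Fin n) :
    DependsOn (homWeight W z₀ F φ) (Set.range φ) := by
  intro x y hxy
  refine Finset.prod_congr rfl fun e _ => ?_
  obtain ⟨e, he⟩ := e
  induction e with | _ i j
  simp [hxy _ (Set.mem_range_self i), hxy _ (Set.mem_range_self j)]

theorem homWeight_of_injective (W : ZGraphon B) (z₀ : StrongDual ℝ B) {k n : ℕ}
    (F : DecoratedGraph B (Fin k)) {φ : Fin k → Fin n} (hφ : Function.Injective φ)
    (x : Fin n → I) : homWeight W z₀ F φ x = homWeight W z₀ F id fun i => x (φ i) := by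
  refine Finset.prod_congr rfl fun e _ => ?_
  obtain ⟨e, he⟩ := e
  induction e with | _ i j
  simp [hφ.eq_iff]

theorem graphonDensity_eq_integral_homWeight (W : ZGraphon B) (z₀ : StrongDual ℝ B) {k : ℕ}
    (F : DecoratedGraph B (Fin k)) :
    graphonDensity F W = ∫ x, homWeight W z₀ F id x := by
  refine integral_congr_ae (ae_of_all _ fun x => Finset.prod_congr rfl fun e _ => ?_)
  obtain ⟨e, he⟩ := e
  induction e with | _ i j
  have hij : i ≠ j := F.graph.ne_of_adj he
  simp [hij, ZGraphon.onPair]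

theorem aestronglyMeasurable_homWeight (W : ZGraphon B) (z₀ : StrongDual ℝ B) {k n : ℕ}
    (F : DecoratedGraph B (Fin k)) (φ : Fin k → Fin n) :
    AEStronglyMeasurable (homWeight W z₀ F φ) volume :=
  (Finset.aemeasurable_fun_prod _ fun e _ =>
    (memLp_sampledGraph_dec W z₀ _ (F.dec e) 0).1.aemeasurable).aestronglyMeasurable

theorem integral_homWeight_of_injective (W : ZGraphon B) (z₀ : StrongDual ℝ B) {k n : ℕ}
    (F : DecoratedGraph B (Fin k)) {φ : Fin k → Fin n} (hφ : Function.Injective φ) :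
    ∫ x, homWeight W z₀ F φ x = graphonDensity F W := by
  have h := measurePreserving_comp_injective hφ
  simp_rw [graphonDensity_eq_integral_homWeight W z₀ F, homWeight_of_injective W z₀ F hφ]
  conv_rhs => rw [← h.map_eq]
  rw [integral_map h.aemeasurable]
  rw [h.map_eq]
  exact aestronglyMeasurable_homWeight W z₀ F id

/-- The fourth moments of the contributions `homWeight` are bounded uniformly in `n` and `φ`. -/
theorem exists_fourth_moment_bound (W : ZGraphon B) (z₀ : StrongDual ℝ B) {k : ℕ}
    (F : DecoratedGraph B (Fin k)) : ∃ C : ℝ, ∀ (n : ℕ) (φ : Fin k → Fin n),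
      Integrable (fun x => homWeight W z₀ F φ x ^ 4) ∧
        ∫ x, homWeight W z₀ F φ x ^ 4 ≤ C := by
  classical
  set m := Fintype.card F.graph.edgeSet with hm
  refine ⟨1 + ∑ e : F.graph.edgeSet, (|z₀ (F.dec e)| ^ (4 * m) +
    ∫ p : I × I, |W.toFun p.1 p.2 (F.dec e)| ^ (4 * m)), fun n φ => ?_⟩
  have hi : ∀ e : F.graph.edgeSet, Integrable (fun x : Fin n → I =>
      |(sampledGraph W z₀ x).dec (Sym2.map φ (e : Sym2 (Fin k))) (F.dec e)| ^ (4 * m)) :=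
    fun e => (memLp_sampledGraph_dec W z₀ _ (F.dec e) (4 * m)).integrable_norm_pow'
  have hD : Integrable (fun x : Fin n → I => 1 + ∑ e : F.graph.edgeSet,
      |(sampledGraph W z₀ x).dec (Sym2.map φ (e : Sym2 (Fin k))) (F.dec e)| ^ (4 * m)) :=
    (integrable_const 1).add (integrable_finsetSum _ fun e _ => hi e)
  have hle : ∀ x, |homWeight W z₀ F φ x ^ 4| ≤ 1 + ∑ e : F.graph.edgeSet,
      |(sampledGraph W z₀ x).dec (Sym2.map φ (e : Sym2 (Fin k))) (F.dec e)| ^ (4 * m) := by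
    intro x
    -- The product bound is applied to the fourth powers of the `m` factors, whence the exponent `4
    -- * m`.
    have h := abs_prod_le_one_add_sum_pow_card (fun e : F.graph.edgeSet =>
      (sampledGraph W z₀ x).dec (Sym2.map φ (e : Sym2 (Fin k))) (F.dec e) ^ 4)
    rw [Finset.prod_pow] at h
    simp only [abs_pow, ← pow_mul] at h ⊢
    convert h using 2
    unfold homWeight
    congr!
  have hint : Integrable (fun x => homWeight W z₀ F φ x ^ 4) :=
    hD.mono' ((aestronglyMeasurable_homWeight W z₀ F φ).pow 4) (ae_of_all _ hle)
  refine ⟨hint, ?_⟩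
  refine (integral_mono hint hD fun x => (le_abs_self _).trans (hle x)).trans ?_
  rw [integral_add (integrable_const 1) (integrable_finsetSum _ fun e _ => hi e),
    integral_finsetSum _ fun e _ => hi e]
  simp only [integral_const, probReal_univ, smul_eq_mul, mul_one]
  gcongr with e
  exact integral_abs_sampledGraph_dec_pow_le W z₀ _ _ _


/-! ### Counting quadruples of maps by their coincidences -/

/-- Overwriting the values at `u` and `u'` arbitrarily loses no information: `ψ u` is recovered from
`ψ v`, which is untouched, and then `ψ u'` from `ψ v'`, where `v'` is either untouched or equal to
`u`. -/
theorem card_filter_two_collisions_mul_sq_le {A C : Type*} [Fintype A] [DecidableEq A]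
    [Fintype C] [DecidableEq C] {u v u' v' : A} (huv : u ≠ v) (hu'v' : u' ≠ v') (hu'u : u' ≠ u)
    (hu'v : u' ≠ v) :
    (Finset.univ.filter fun ψ : A → C => ψ u = ψ v ∧ ψ u' = ψ v').card * Fintype.card C ^ 2 ≤
      Fintype.card C ^ Fintype.card A := by
  have h := Finset.card_le_card_of_injOn
    (s := (Finset.univ.filter fun ψ : A → C => ψ u = ψ v ∧ ψ u' = ψ v') ×ˢ
      (Finset.univ : Finset (C × C)))
    (t := (Finset.univ : Finset (A → C)))
    (fun q => Function.update (Function.update q.1 u q.2.1) u' q.2.2)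
    (fun _ _ => Finset.mem_coe.2 (Finset.mem_univ _)) ?_
  · simpa [Finset.card_product, sq] using h
  rintro ⟨ψ, c, c'⟩ hψ ⟨χ, d, d'⟩ hχ heq
  simp only [Finset.coe_product, Finset.coe_filter, Finset.mem_univ, true_and, Set.mem_prod,
    Set.mem_ofPred_eq] at hψ hχ
  have hw : ∀ w, w ≠ u → w ≠ u' → ψ w = χ w := fun w h1 h2 => by
    simpa [h1, h2] using congrFun heq w
  have hc : c = d := by simpa [hu'u.symm] using congrFun heq u
  have hc' : c' = d' := by simpa using congrFun heq u'
  have hu : ψ u = χ u := by rw [hψ.1.1, hχ.1.1, hw v huv.symm hu'v.symm]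
  have hu' : ψ u' = χ u' := by
    rw [hψ.1.2, hχ.1.2]
    rcases eq_or_ne v' u with rfl | hne
    · exact hu
    · exact hw v' hne hu'v'.symm
  have : ψ = χ := by
    funext w
    by_cases h1 : w = u
    · rw [h1, hu]
    by_cases h2 : w = u'
    · rw [h2, hu']
    exact hw w h1 h2
  simp [this, hc, hc']

/-- The map `Φ a` is injective and its range avoids the ranges of all other maps `Φ b`. -/
def IsIsolated {k n : ℕ} (Φ : Fin 4 → Fin k → Fin n) (a : Fin 4) : Prop :=
  Function.Injective (Φ a) ∧ ∀ b, b ≠ a → Disjoint (Set.range (Φ a)) (Set.range (Φ b))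

theorem exists_collision_of_not_isIsolated {k n : ℕ} {Φ : Fin 4 → Fin k → Fin n} {a : Fin 4}
    (h : ¬ IsIsolated Φ a) :
    ∃ u v : Fin 4 × Fin k, u.1 = a ∧ u ≠ v ∧ Φ u.1 u.2 = Φ v.1 v.2 := by
  by_cases hinj : Function.Injective (Φ a)
  · simp only [IsIsolated, hinj, true_and, not_forall] at h
    obtain ⟨b, hb, hd⟩ := h
    obtain ⟨_, ⟨i, rfl⟩, ⟨j, hj⟩⟩ := Set.not_disjoint_iff.1 hd
    exact ⟨(a, i), (b, j), rfl, fun h => hb (congrArg Prod.fst h).symm, hj.symm⟩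
  · simp only [Function.Injective, not_forall] at hinj
    obtain ⟨i, j, hij, hne⟩ := hinj
    exact ⟨(a, i), (a, j), rfl, fun h => hne (congrArg Prod.snd h), hij⟩

-- Each non-isolated map forces a coincidence involving one of its own values. Two such
-- coincidences, chosen so that the second constrains a fresh value, cost a factor `n ^ 2`; there
-- are at most `(4 * k) ^ 4` places for them.
open Classical in
theorem card_filter_no_isIsolated_mul_sq_le (k n : ℕ) :
    (Finset.univ.filter fun Φ : Fin 4 → Fin k → Fin n => ∀ a, ¬ IsIsolated Φ a).card * n ^ 2 ≤
      (4 * k) ^ 4 * n ^ (4 * k) := by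
  let A := Fin 4 × Fin k
  let T : Finset (A × A × A × A) := Finset.univ.filter fun q =>
    q.1 ≠ q.2.1 ∧ q.2.2.1 ≠ q.2.2.2 ∧ q.2.2.1 ≠ q.1 ∧ q.2.2.1 ≠ q.2.1
  let N : A × A × A × A → Finset (A → Fin n) := fun q => Finset.univ.filter fun ψ =>
    ψ q.1 = ψ q.2.1 ∧ ψ q.2.2.1 = ψ q.2.2.2
  have h1 : (Finset.univ.filter fun Φ : Fin 4 → Fin k → Fin n => ∀ a, ¬ IsIsolated Φ a).card ≤
      (T.biUnion N).card := by
    refine Finset.card_le_card_of_injOn (fun Φ u => Φ u.1 u.2) (fun Φ hΦ => ?_)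
      (fun Φ _ Ψ _ h => ?_)
    · simp only [Finset.coe_filter, Finset.mem_univ, true_and, Set.mem_ofPred_eq] at hΦ
      obtain ⟨u, v, hu, huv, he⟩ := exists_collision_of_not_isIsolated (hΦ 0)
      -- The second coincidence is taken at a map involved in neither end of the first, so that `u'`
      -- differs from `u` and `v`.
      obtain ⟨a, ha0, hav⟩ : ∃ a : Fin 4, a ≠ 0 ∧ a ≠ v.1 := by
        generalize v.1 = b
        revert b
        decide
      obtain ⟨u', v', hu', huv', he'⟩ := exists_collision_of_not_isIsolated (hΦ a)
      simp only [Finset.coe_biUnion, Set.mem_iUnion]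
      refine ⟨(u, v, u', v'), ?_, ?_⟩
      · simp only [T, Finset.coe_filter, Finset.mem_univ, true_and, Set.mem_ofPred_eq]
        refine ⟨huv, huv', ?_, ?_⟩
        · rintro rfl
          exact ha0 (hu'.symm.trans hu)
        · rintro rfl
          exact hav hu'.symm
      · simp [N, he, he']
    · funext a i
      exact congrFun h (a, i)
  have h2 : ∀ q ∈ T, (N q).card * n ^ 2 ≤ n ^ (4 * k) := by
    intro q hq
    simp only [T, Finset.mem_filter, Finset.mem_univ, true_and] at hq
    have h := card_filter_two_collisions_mul_sq_le (C := Fin n) hq.1 hq.2.1 hq.2.2.1 hq.2.2.2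
    simpa [A, N] using h
  calc _ ≤ (T.biUnion N).card * n ^ 2 := Nat.mul_le_mul_right _ h1
    _ ≤ (∑ q ∈ T, (N q).card) * n ^ 2 := Nat.mul_le_mul_right _ Finset.card_biUnion_le
    _ = ∑ q ∈ T, (N q).card * n ^ 2 := Finset.sum_mul _ _ _
    _ ≤ ∑ _q ∈ T, n ^ (4 * k) := Finset.sum_le_sum h2
    _ = T.card * n ^ (4 * k) := by simp
    _ ≤ (4 * k) ^ 4 * n ^ (4 * k) := by
      refine Nat.mul_le_mul_right _ ((Finset.card_le_univ T).trans_eq ?_)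
      simp only [A, Fintype.card_prod, Fintype.card_fin]
      ring

/-! ### The fourth central moment of the density -/

theorem integrable_homWeight (W : ZGraphon B) (z₀ : StrongDual ℝ B) {k n : ℕ}
    (F : DecoratedGraph B (Fin k)) (φ : Fin k → Fin n) : Integrable (homWeight W z₀ F φ) := by
  obtain ⟨C, hC⟩ := exists_fourth_moment_bound W z₀ F
  have hm := aestronglyMeasurable_homWeight W z₀ F φ
  have h4 : Integrable (fun x => ‖homWeight W z₀ F φ x‖ ^ 4) := by
    simpa [Even.pow_abs (show Even 4 by decide)] using (hC n φ).1
  have h1 := integrable_norm_pow_of_le hm (show 1 ≤ 4 by norm_num) h4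
  simp only [pow_one] at h1
  exact (integrable_norm_iff hm).1 h1

/-- The factor of `Φ a` depends only on the coordinates in its range and the others only on the
complement, so the integral factorises; injectivity makes the first factor centred. -/
theorem integral_prod_homWeight_sub_eq_zero (W : ZGraphon B) (z₀ : StrongDual ℝ B) {k n : ℕ}
    (F : DecoratedGraph B (Fin k)) {Φ : Fin 4 → Fin k → Fin n} {a : Fin 4} (h : IsIsolated Φ a) :
    ∫ x, ∏ b, (homWeight W z₀ F (Φ b) x - graphonDensity F W) = 0 := by
  have hint := integrable_homWeight W z₀ F (Φ a)
  have hzero : ∫ x, (homWeight W z₀ F (Φ a) x - graphonDensity F W) = 0 := by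
    rw [integral_sub hint (integrable_const _), integral_homWeight_of_injective W z₀ F h.1]
    simp
  simp_rw [← Finset.mul_prod_erase Finset.univ _ (Finset.mem_univ a)]
  rw [integral_mul_of_dependsOn (s := Set.range (Φ a)) (t := (Set.range (Φ a))ᶜ)
    disjoint_compl_right, hzero, zero_mul]
  · intro x y hxy
    simp only [dependsOn_homWeight W z₀ F (Φ a) hxy]
  · intro x y hxy
    refine Finset.prod_congr rfl fun b hb => ?_
    rw [dependsOn_homWeight W z₀ F (Φ b) fun i hi => hxy i
      (Set.disjoint_right.1 (h.2 b (Finset.ne_of_mem_erase hb)) hi)]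

theorem exists_integral_prod_homWeight_sub_le (W : ZGraphon B) (z₀ : StrongDual ℝ B) {k : ℕ}
    (F : DecoratedGraph B (Fin k)) : ∃ C : ℝ, 0 ≤ C ∧ ∀ (n : ℕ) (Φ : Fin 4 → Fin k → Fin n),
      Integrable (fun x => ∏ b, (homWeight W z₀ F (Φ b) x - graphonDensity F W)) ∧
        ∫ x, ∏ b, (homWeight W z₀ F (Φ b) x - graphonDensity F W) ≤ C := by
  obtain ⟨C, hC⟩ := exists_fourth_moment_bound W z₀ F
  set t := graphonDensity F W
  have hC0 : 0 ≤ C := (integral_nonneg fun x => by positivity).trans (hC k id).2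
  -- The 8 comes from `(y - t) ^ 4 ≤ 8 * (y ^ 4 + t ^ 4)`, used after the product bound for four
  -- factors.
  refine ⟨1 + ∑ _b : Fin 4, 8 * (C + t ^ 4), by positivity, fun n Φ => ?_⟩
  have hi : ∀ b, Integrable (fun x => 8 * (homWeight W z₀ F (Φ b) x ^ 4 + t ^ 4)) :=
    fun b => ((hC n (Φ b)).1.add (integrable_const _)).const_mul 8
  have hD : Integrable (fun x => 1 + ∑ b, 8 * (homWeight W z₀ F (Φ b) x ^ 4 + t ^ 4)) :=
    (integrable_const 1).add (integrable_finsetSum _ fun b _ => hi b)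
  have hle : ∀ x, |∏ b, (homWeight W z₀ F (Φ b) x - t)| ≤
      1 + ∑ b, 8 * (homWeight W z₀ F (Φ b) x ^ 4 + t ^ 4) := by
    intro x
    refine (abs_prod_le_one_add_sum_pow_card _).trans ?_
    gcongr with b
    rw [Fintype.card_fin, Even.pow_abs (by decide), sub_eq_add_neg]
    have h := (show Even 4 by decide).add_pow_le (a := homWeight W z₀ F (Φ b) x) (b := -t)
    norm_num [Even.neg_pow (show Even 4 by decide)] at h
    exact h
  have hint : Integrable (fun x => ∏ b, (homWeight W z₀ F (Φ b) x - t)) := by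
    refine hD.mono' ?_ (ae_of_all _ hle)
    exact (Finset.aemeasurable_fun_prod _ fun b _ =>
      (aestronglyMeasurable_homWeight W z₀ F (Φ b)).aemeasurable.sub_const t).aestronglyMeasurable
  refine ⟨hint, (integral_mono hint hD fun x => (le_abs_self _).trans (hle x)).trans ?_⟩
  rw [integral_add (integrable_const 1) (integrable_finsetSum _ fun b _ => hi b),
    integral_finsetSum _ fun b _ => hi b]
  simp only [integral_const, probReal_univ, smul_eq_mul, mul_one]
  gcongr with b
  rw [integral_const_mul, integral_add (hC n (Φ b)).1 (integrable_const _)]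
  simp only [integral_const, probReal_univ, smul_eq_mul, one_mul]
  gcongr
  exact (hC n (Φ b)).2

theorem homDensity_sub_pow_four (W : ZGraphon B) (z₀ : StrongDual ℝ B) {k n : ℕ} (hn : n ≠ 0)
    (F : DecoratedGraph B (Fin k)) (t : ℝ) (x : Fin n → I) :
    (homDensity F (sampledGraph W z₀ x) - t) ^ 4 =
      (∑ Φ : Fin 4 → Fin k → Fin n, ∏ b, (homWeight W z₀ F (Φ b) x - t)) / n ^ (4 * k) := by
  have hn' : (n : ℝ) ≠ 0 := Nat.cast_ne_zero.2 hn
  have h : homDensity F (sampledGraph W z₀ x) - t =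
      (∑ φ : Fin k → Fin n, (homWeight W z₀ F φ x - t)) / n ^ k := by
    rw [homDensity, hom_sampledGraph, Finset.sum_sub_distrib]
    simp only [Fintype.card_fin, Finset.sum_const, Finset.card_univ, Fintype.card_fun,
      nsmul_eq_mul, Nat.cast_pow]
    field_simp
  rw [h, div_pow, ← pow_mul, mul_comm k 4, Finset.sum_pow', Fintype.piFinset_univ]

/-- The fourth moment of `t(F, G(n, W)) - t(F, W)` is `O(n⁻²)`. -/
theorem exists_integral_homDensity_sub_pow_four_le (W : ZGraphon B) (z₀ : StrongDual ℝ B) {k : ℕ}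
    (F : DecoratedGraph B (Fin k)) : ∃ C : ℝ, ∀ n : ℕ, n ≠ 0 →
      Integrable (fun x : Fin n → I =>
        (homDensity F (sampledGraph W z₀ x) - graphonDensity F W) ^ 4) ∧
      ∫ x : Fin n → I, (homDensity F (sampledGraph W z₀ x) - graphonDensity F W) ^ 4 ≤
        C / (n : ℝ) ^ 2 := by
  classical
  obtain ⟨C, hC0, hC⟩ := exists_integral_prod_homWeight_sub_le W z₀ F
  refine ⟨(4 * k) ^ 4 * C, fun n hn => ?_⟩
  have hn' : (0 : ℝ) < n := Nat.cast_pos.2 (Nat.pos_of_ne_zero hn)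
  simp_rw [homDensity_sub_pow_four W z₀ hn F]
  refine ⟨(integrable_finsetSum _ fun Φ _ => (hC n Φ).1).div_const _, ?_⟩
  rw [integral_div, integral_finsetSum _ fun Φ _ => (hC n Φ).1]
  set S := Finset.univ.filter fun Φ : Fin 4 → Fin k → Fin n => ∀ a, ¬ IsIsolated Φ a with hS
  -- Quadruples with an isolated map contribute zero, and each of the others at most `C`.
  have h1 : ∑ Φ : Fin 4 → Fin k → Fin n,
      ∫ x, ∏ b, (homWeight W z₀ F (Φ b) x - graphonDensity F W) ≤ S.card * C := by
    rw [← nsmul_eq_mul, ← Finset.sum_const, hS, Finset.sum_filter]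
    refine Finset.sum_le_sum fun Φ _ => ?_
    split_ifs with h
    · exact (hC n Φ).2
    · push Not at h
      obtain ⟨a, ha⟩ := h
      exact (integral_prod_homWeight_sub_eq_zero W z₀ F ha).le
  have h2 : (S.card : ℝ) * n ^ 2 ≤ (4 * k) ^ 4 * n ^ (4 * k) := by
    exact_mod_cast card_filter_no_isIsolated_mul_sq_le k n
  rw [div_le_div_iff₀ (by positivity) (by positivity)]
  calc _ ≤ S.card * C * (n : ℝ) ^ 2 := by gcongr
    _ = C * (S.card * (n : ℝ) ^ 2) := by ring
    _ ≤ C * ((4 * k) ^ 4 * n ^ (4 * k)) := by gcongr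
    _ = _ := by ring


/-! ### From summable fourth moments to almost sure convergence -/

/-- By Tonelli, the sum of the fourth powers has finite integral, so it is finite almost everywhere
and its terms tend to 0. The joint law of the `Y n` plays no role. -/
theorem ae_tendsto_of_summable_integral_pow {Ω : Type*} [MeasurableSpace Ω] {P : Measure Ω}
    {Y : ℕ → Ω → ℝ} {t : ℝ} {c : ℕ → ℝ} (hc : Summable c)
    (hint : ∀ n, Integrable (fun ω => (Y n ω - t) ^ 4) P)
    (hle : ∀ n, ∫ ω, (Y n ω - t) ^ 4 ∂P ≤ c n) :
    ∀ᵐ ω ∂P, Tendsto (fun n => Y n ω) atTop (𝓝 t) := by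
  have hpos : ∀ n ω, 0 ≤ (Y n ω - t) ^ 4 := fun n ω => by positivity
  have hm : ∀ n, AEMeasurable (fun ω => ENNReal.ofReal ((Y n ω - t) ^ 4)) P :=
    fun n => (hint n).aemeasurable.ennreal_ofReal
  have hfin : ∫⁻ ω, ∑' n, ENNReal.ofReal ((Y n ω - t) ^ 4) ∂P ≠ ∞ := by
    rw [lintegral_tsum hm]
    refine ne_top_of_le_ne_top hc.tsum_ofReal_ne_top (ENNReal.tsum_le_tsum fun n => ?_)
    rw [← ofReal_integral_eq_lintegral_ofReal (hint n) (ae_of_all _ (hpos n))]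
    exact ENNReal.ofReal_le_ofReal (hle n)
  filter_upwards [ae_lt_top' (AEMeasurable.tsum hm) hfin] with ω hω
  have h0 := ENNReal.tendsto_atTop_zero_of_tsum_ne_top hω.ne
  have h1 : Tendsto (fun n => (Y n ω - t) ^ 4) atTop (𝓝 0) := by
    simpa [Function.comp_def, ENNReal.toReal_ofReal (hpos _ ω)] using
      (ENNReal.tendsto_toReal ENNReal.zero_ne_top).comp h0
  have h2 : Tendsto (fun n => |Y n ω - t|) atTop (𝓝 0) := by
    have h := (h1.sqrt).sqrt
    simp only [Real.sqrt_zero] at h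
    refine h.congr fun n => ?_
    rw [show (Y n ω - t) ^ 4 = ((Y n ω - t) ^ 2) ^ 2 by ring, Real.sqrt_sq (by positivity),
      Real.sqrt_sq_eq_abs]
  rw [tendsto_iff_norm_sub_tendsto_zero]
  exact h2

/-- `t(F, G(n, W)) → t(F, W)` almost surely, for samples coupled in an arbitrary way. -/
theorem ae_tendsto_homDensity_sampledGraph (W : ZGraphon B) {k : ℕ}
    (F : DecoratedGraph B (Fin k)) (z₀ : StrongDual ℝ B) {Ω : Type*} [MeasurableSpace Ω]
    (P : Measure Ω) [IsProbabilityMeasure P] (X : ∀ n : ℕ, Fin n → Ω → I)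
    (hX : ∀ n i, Measurable (X n i)) (hlaw : ∀ n i, P.map (X n i) = (volume : Measure I))
    (hind : ∀ n, iIndepFun (X n) P) :
    ∀ᵐ ω ∂P, Tendsto
      (fun n : ℕ => homDensity F (sampledGraph W z₀ (fun i : Fin n => X n i ω)))
      atTop (𝓝 (graphonDensity F W)) := by
  obtain ⟨C, hC⟩ := exists_integral_homDensity_sub_pow_four_le W z₀ F
  have hmp : ∀ n, MeasurePreserving (fun ω (i : Fin n) => X n i ω) P volume := fun n => by
    refine ⟨measurable_pi_lambda _ (hX n), ?_⟩
    rw [(iIndepFun_iff_map_fun_eq_pi_map fun i => (hX n i).aemeasurable).1 (hind n), volume_pi]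
    simp_rw [hlaw n]
  -- The index is shifted because the moment bound requires `n ≠ 0`.
  have hsum : Summable fun n : ℕ => C / ((n + 1 : ℕ) : ℝ) ^ 2 := by
    simp_rw [div_eq_mul_inv]
    exact ((summable_nat_add_iff 1).2 (Real.summable_nat_pow_inv.2 one_lt_two)).mul_left C
  have h := ae_tendsto_of_summable_integral_pow (P := P) (t := graphonDensity F W)
    (Y := fun n ω => homDensity F (sampledGraph W z₀ (fun i : Fin (n + 1) => X (n + 1) i ω)))
    hsum (fun n => (hmp (n + 1)).integrable_comp_of_integrable (hC (n + 1) n.succ_ne_zero).1)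
    (fun n => ?_)
  · filter_upwards [h] with ω hω
    exact (tendsto_add_atTop_iff_nat 1).1 hω
  · refine le_trans (le_of_eq ?_) (hC (n + 1) n.succ_ne_zero).2
    rw [← (hmp (n + 1)).map_eq, integral_map (hmp (n + 1)).aemeasurable]
    rw [(hmp (n + 1)).map_eq]
    exact (hC (n + 1) n.succ_ne_zero).1.1

/-! ### Continuity in the decoration and one sample for all graphs -/

/-- The real-valued graphon `(x, y) ↦ ‖W(x, y)‖`. -/
def ZGraphon.normGraphon (W : ZGraphon B) : ZGraphon ℝ where
  toFun x y := ‖W.toFun x y‖ • ContinuousLinearMap.id ℝ ℝ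
  symm' x y := by rw [W.symm' x y]
  weakStarMeasurable' b := by
    simpa using (W.memLp_norm' 1 le_rfl (by simp)).1.aemeasurable.mul_const b
  memLp_norm' p hp hp' := by
    simpa [norm_smul] using W.memLp_norm' p hp hp'

theorem sampledGraph_normGraphon_dec (W : ZGraphon B) {n : ℕ} (x : Fin n → I)
    (e : Sym2 (Fin n)) :
    (sampledGraph W.normGraphon 0 x).dec e 1 = ‖(sampledGraph W 0 x).dec e‖ := by
  induction e with | _ i j
  by_cases hij : i = j <;> simp [hij, ZGraphon.normGraphon]

/-- The product is multilinear in the decorations, with norm at most `∏ i, ‖a i‖`; changing them one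
at a time gives the bound. -/
theorem abs_prod_apply_sub_prod_apply_le {ι : Type*} [Fintype ι] (a : ι → StrongDual ℝ B)
    (f g : ι → B) :
    |∏ i, a i (f i) - ∏ i, a i (g i)| ≤
      (Fintype.card ι * max ‖f‖ ‖g‖ ^ (Fintype.card ι - 1) * ‖f - g‖) * ∏ i, ‖a i‖ := by
  have h := MultilinearMap.norm_image_sub_le_of_bound (C := ∏ i, ‖a i‖)
    ((MultilinearMap.mkPiAlgebra ℝ ι ℝ).compLinearMap fun i => (a i : B →ₗ[ℝ] ℝ))
    (by positivity) (fun m => ?_) f g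
  · simp only [MultilinearMap.compLinearMap_apply, MultilinearMap.mkPiAlgebra_apply,
      ContinuousLinearMap.coe_coe, Real.norm_eq_abs] at h
    exact h.trans_eq (by ring)
  · simp only [MultilinearMap.compLinearMap_apply, MultilinearMap.mkPiAlgebra_apply,
      ContinuousLinearMap.coe_coe, norm_prod, ← Finset.prod_mul_distrib]
    exact Finset.prod_le_prod (fun _ _ => norm_nonneg _) fun i _ => (a i).le_opNorm _

open Classical in
/-- The modulus of continuity of the densities with respect to the decoration. -/
def decDist {k : ℕ} (H : SimpleGraph (Fin k)) (f g : H.edgeSet → B) : ℝ :=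
  Fintype.card H.edgeSet * max ‖f‖ ‖g‖ ^ (Fintype.card H.edgeSet - 1) * ‖f - g‖

theorem decDist_nonneg {D : Type*} [NormedAddCommGroup D] {k : ℕ} (H : SimpleGraph (Fin k))
    (f g : H.edgeSet → D) : 0 ≤ decDist H f g := by
  classical
  exact mul_nonneg (mul_nonneg (Nat.cast_nonneg _)
    (pow_nonneg (le_max_of_le_left (norm_nonneg _)) _)) (norm_nonneg _)

/-- The error is expressed through a contribution for the graphon `‖W‖` with all decorations 1, to
which the sampling theorem applies again. Loop label 0 keeps the two samples compatible. -/
theorem abs_homWeight_sub_homWeight_le (W : ZGraphon B) {k n : ℕ} (H : SimpleGraph (Fin k))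
    (f g : H.edgeSet → B) (φ : Fin k → Fin n) (x : Fin n → I) :
    |homWeight W 0 ⟨H, f⟩ φ x - homWeight W 0 ⟨H, g⟩ φ x| ≤
      decDist H f g * homWeight W.normGraphon 0 ⟨H, fun _ => 1⟩ φ x := by
  classical
  have h := abs_prod_apply_sub_prod_apply_le (fun e : H.edgeSet =>
    (sampledGraph W 0 x).dec (Sym2.map φ (e : Sym2 (Fin k)))) f g
  simp only [← sampledGraph_normGraphon_dec] at h
  unfold homWeight decDist
  convert h

theorem abs_homDensity_sub_homDensity_le (W : ZGraphon B) {k n : ℕ} (H : SimpleGraph (Fin k))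
    (f g : H.edgeSet → B) (x : Fin n → I) :
    |homDensity ⟨H, f⟩ (sampledGraph W 0 x) - homDensity ⟨H, g⟩ (sampledGraph W 0 x)| ≤
      decDist H f g * homDensity ⟨H, fun _ => 1⟩ (sampledGraph W.normGraphon 0 x) := by
  simp only [homDensity, hom_sampledGraph]
  rw [← sub_div, ← Finset.sum_sub_distrib, abs_div, ← mul_div_assoc,
    abs_of_nonneg (a := (Fintype.card (Fin n) : ℝ) ^ Fintype.card (Fin k)) (by positivity),
    Finset.mul_sum]
  gcongr
  exact (Finset.abs_sum_le_sum_abs _ _).trans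
    (Finset.sum_le_sum fun φ _ => abs_homWeight_sub_homWeight_le W H f g φ x)

theorem abs_graphonDensity_sub_graphonDensity_le (W : ZGraphon B) {k : ℕ}
    (H : SimpleGraph (Fin k)) (f g : H.edgeSet → B) :
    |graphonDensity ⟨H, f⟩ W - graphonDensity ⟨H, g⟩ W| ≤
      decDist H f g * graphonDensity ⟨H, fun _ => 1⟩ W.normGraphon := by
  rw [graphonDensity_eq_integral_homWeight W 0, graphonDensity_eq_integral_homWeight W 0,
    graphonDensity_eq_integral_homWeight W.normGraphon 0, ← integral_const_mul,
    ← integral_sub (integrable_homWeight _ _ _ _) (integrable_homWeight _ _ _ _)]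
  refine (abs_integral_le_integral_abs).trans (integral_mono ?_ ?_ fun x =>
    abs_homWeight_sub_homWeight_le W H f g id x)
  · exact ((integrable_homWeight _ _ _ _).sub (integrable_homWeight _ _ _ _)).abs
  · exact (integrable_homWeight _ _ _ _).const_mul _

/-- `decDist H f` is continuous and vanishes at `f`, and decorations from a dense sequence are dense
because `H` has finitely many edges. -/
theorem exists_decDist_lt {D : Type*} [NormedAddCommGroup D] [TopologicalSpace.SeparableSpace D]
    {k : ℕ} (H : SimpleGraph (Fin k)) (f : H.edgeSet → D) {ε : ℝ} (hε : 0 < ε) :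
    ∃ a : H.edgeSet → ℕ, decDist H f (fun e => TopologicalSpace.denseSeq D (a e)) < ε := by
  classical
  have hd : DenseRange (fun (a : H.edgeSet → ℕ) e => TopologicalSpace.denseSeq D (a e)) :=
    DenseRange.piMap fun _ => TopologicalSpace.denseRange_denseSeq D
  have hcont : Continuous fun g => decDist H f g := by
    unfold decDist
    fun_prop
  exact hd.exists_mem_open (isOpen_lt hcont continuous_const) ⟨f, by simpa [decDist] using hε⟩

theorem tendsto_homDensity_of_dense [TopologicalSpace.SeparableSpace B] (W : ZGraphon B) {k : ℕ}
    (H : SimpleGraph (Fin k)) (x : ∀ n : ℕ, Fin n → I)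
    (hnorm : Tendsto (fun n => homDensity ⟨H, fun _ => 1⟩ (sampledGraph W.normGraphon 0 (x n)))
      atTop (𝓝 (graphonDensity ⟨H, fun _ => 1⟩ W.normGraphon)))
    (hdense : ∀ a : H.edgeSet → ℕ, Tendsto (fun n => homDensity
      ⟨H, fun e => TopologicalSpace.denseSeq B (a e)⟩ (sampledGraph W 0 (x n)))
      atTop (𝓝 (graphonDensity ⟨H, fun e => TopologicalSpace.denseSeq B (a e)⟩ W)))
    (f : H.edgeSet → B) :
    Tendsto (fun n => homDensity ⟨H, f⟩ (sampledGraph W 0 (x n))) atTop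
      (𝓝 (graphonDensity ⟨H, f⟩ W)) := by
  set s := graphonDensity ⟨H, fun _ => 1⟩ W.normGraphon
  rw [Metric.tendsto_atTop']
  intro ε hε
  -- `M` bounds the limit `s` and, strictly, all late densities of `‖W‖`, so one `δ` serves both
  -- outer terms of the `ε / 3` argument.
  set M := |s| + 1 with hM
  have hMpos : 0 < M := by positivity
  obtain ⟨a, ha⟩ := exists_decDist_lt H f (ε := ε / 3 / M) (by positivity)
  set g : H.edgeSet → B := fun e => TopologicalSpace.denseSeq B (a e)
  have hδ : decDist H f g * M < ε / 3 := (lt_div_iff₀ hMpos).1 ha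
  have hδ0 := decDist_nonneg H f g
  have h1 : ∀ᶠ n in atTop,
      homDensity ⟨H, fun _ => 1⟩ (sampledGraph W.normGraphon 0 (x n)) < M :=
    hnorm.eventually_lt_const (by linarith [le_abs_self s])
  have h2 := (Metric.tendsto_nhds.1 (hdense a)) (ε / 3) (by positivity)
  obtain ⟨N, hN⟩ := eventually_atTop.1 (h1.and h2)
  refine ⟨N, fun n hn => ?_⟩
  obtain ⟨h3, h4⟩ := hN n hn.le
  have h5 := (abs_homDensity_sub_homDensity_le W H f g (x n)).trans
    (mul_le_mul_of_nonneg_left h3.le hδ0)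
  have h6 := (abs_graphonDensity_sub_graphonDensity_le W H f g).trans
    (mul_le_mul_of_nonneg_left (show s ≤ M by linarith [le_abs_self s]) hδ0)
  rw [Real.dist_eq, abs_lt] at *
  rw [abs_le] at h5 h6
  constructor <;> linarith [h5.1, h5.2, h6.1, h6.2, h4.1, h4.2]

theorem exists_points_tendsto_homDensity [TopologicalSpace.SeparableSpace B] (W : ZGraphon B) :
    ∃ x : ∀ n : ℕ, Fin n → I, ∀ (k : ℕ) (F : DecoratedGraph B (Fin k)),
      Tendsto (fun n => homDensity F (sampledGraph W 0 (x n))) atTop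
        (𝓝 (graphonDensity F W)) := by
  -- The samples are coupled as initial segments of one i.i.d. sequence. Only countably many triples
  -- `(k, H, a)` occur, so a single `ω` is good for all of them.
  let P : Measure (ℕ → I) := Measure.infinitePi fun _ => volume
  let X : ∀ n : ℕ, Fin n → (ℕ → I) → I := fun n i ω => ω i
  have hX : ∀ n i, Measurable (X n i) := fun n i => measurable_pi_apply _
  have hlaw : ∀ n i, P.map (X n i) = (volume : Measure I) := fun n i =>
    (measurePreserving_eval_infinitePi (fun _ : ℕ => (volume : Measure I)) (i : ℕ)).map_eq
  have hind : ∀ n, iIndepFun (X n) P := fun n =>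
    (iIndepFun_infinitePi (P := fun _ : ℕ => (volume : Measure I))
      (X := fun (_ : ℕ) (t : I) => t) fun _ => measurable_id).precomp Fin.val_injective
  have hnorm : ∀ᵐ ω ∂P, ∀ (k : ℕ) (H : SimpleGraph (Fin k)), Tendsto (fun n : ℕ =>
      homDensity ⟨H, fun _ => 1⟩ (sampledGraph W.normGraphon 0 (fun i : Fin n => X n i ω)))
      atTop (𝓝 (graphonDensity ⟨H, fun _ => 1⟩ W.normGraphon)) :=
    ae_all_iff.2 fun k => ae_all_iff.2 fun H =>
      ae_tendsto_homDensity_sampledGraph W.normGraphon _ 0 P X hX hlaw hind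
  have hdense : ∀ᵐ ω ∂P, ∀ (k : ℕ) (H : SimpleGraph (Fin k)) (a : H.edgeSet → ℕ),
      Tendsto (fun n : ℕ => homDensity ⟨H, fun e => TopologicalSpace.denseSeq B (a e)⟩
        (sampledGraph W 0 (fun i : Fin n => X n i ω)))
      atTop (𝓝 (graphonDensity ⟨H, fun e => TopologicalSpace.denseSeq B (a e)⟩ W)) :=
    ae_all_iff.2 fun k => ae_all_iff.2 fun H => ae_all_iff.2 fun a =>
      ae_tendsto_homDensity_sampledGraph W _ 0 P X hX hlaw hind
  obtain ⟨ω, h1, h2⟩ := (hnorm.and hdense).exists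
  exact ⟨fun n i => X n i ω, fun k F =>
    tendsto_homDensity_of_dense W F.graph _ (h1 k F.graph) (h2 k F.graph) F.dec⟩

end BanachGraphon

end

theorem mainTheorem3 {B : Type*} [NormedAddCommGroup B] [NormedSpace ℝ B]
    [CompleteSpace B] [TopologicalSpace.SeparableSpace B] (W : BanachGraphon.ZGraphon B) :
    -- `t(F, G(n, W)) → t(F, W)` almost surely, whatever the joint law of the samples for
    -- different `n`, and whatever fixed label `z₀` the loops carry
    (∀ (k : ℕ) (F : BanachGraphon.DecoratedGraph B (Fin k)) (z₀ : StrongDual ℝ B)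
      (Ω : Type*) [MeasurableSpace Ω] (P : Measure Ω) [IsProbabilityMeasure P]
      (X : ∀ n : ℕ, Fin n → Ω → I),
      (∀ n i, Measurable (X n i)) →
      (∀ n i, P.map (X n i) = (volume : Measure I)) →
      (∀ n, iIndepFun (X n) P) →
      ∀ᵐ ω ∂P, Tendsto
        (fun n : ℕ => BanachGraphon.homDensity F
          (BanachGraphon.sampledGraph W z₀ (fun i : Fin n => X n i ω)))
        atTop (𝓝 (BanachGraphon.graphonDensity F W))) ∧
    -- `W` is the limit of a convergent sequence of loopless `Z`-decorated graphs
    (∃ G : ∀ n : ℕ, BanachGraphon.CompleteDecoratedGraph (StrongDual ℝ B) (Fin (n + 1)),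
      (∀ n i, (G n).dec s(i, i) = 0) ∧
      BanachGraphon.IsConvergent G ∧ BanachGraphon.IsLimit G W) := by
  refine ⟨fun k F z₀ Ω _ P _ X hX hlaw hind =>
    BanachGraphon.ae_tendsto_homDensity_sampledGraph W F z₀ P X hX hlaw hind, ?_⟩
  obtain ⟨x, hx⟩ := BanachGraphon.exists_points_tendsto_homDensity W
  have hlim : BanachGraphon.IsLimit
      (fun n => BanachGraphon.sampledGraph W 0 (x (n + 1))) W := fun k F =>
    (tendsto_add_atTop_iff_nat 1).2 (hx k F)
  exact ⟨fun n => BanachGraphon.sampledGraph W 0 (x (n + 1)), fun n i => by simp,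
    fun k F => ⟨_, hlim k F⟩, hlim⟩
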